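/- Let $\Gamma$ be an infinite set, and let $\ell_\infty(\Gamma)$ be the Banach space of all bounded functions $\Gamma \to \mathbb{C}$ with the supremum norm. For a Banach space $E$ write $S(E) = \{x \in E : \|x\| = 1\}$. Then $\ell_\infty(\Gamma)$ satisfies the Mazur–Ulam property, that is: for every complex Banach space $X$ and every surjective isometry $\Delta : S(\ell_\infty(\Gamma)) \to S(X)$ (that is, a surjective map with $\|\Delta(x) - \Delta(y)\| = \|x - y\|$ for all $x, y \in S(\ell_\infty(\Gamma))$), there is a unique surjective real-linear isometry $T : \ell_\infty(\Gamma) \to X$ with $T(x) = \Delta(x)$ for all $x \in S(\ell_\infty(\Gamma))$. -/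

import Mathlib

open Metric
open scoped ENNReal

/-! The set of unit vectors with a prescribed unimodular value `μ` at one coordinate `j` is
described by distances alone, so `Δ` carries it onto a face of the ball of `X`, supported by a
functional `φ` (`exists_functional_of_coordinate`). The crux, `functional_eq`, is that `φ (Δ x)` is
the real part of `x j / μ` for every `x`. It rests on `map_midpoint_of_norm_sub_eq`: `Δ` preserves
certain midpoints, because midpoints in `ℂ` are metrically unique. Along suitable segments `φ ∘ Δ`
then respects halving, while Lipschitz bounds make it tangent to the expected constant. Taking `μ =
1` and `μ = I` at every coordinate recovers `x` real-linearly from `Δ x`, and this left inverse is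
an isometry whose inverse is `T`. -/

/-! ### Faces of the unit ball and their supporting functionals. -/

/-- Every unit vector lies in a convex subset of the unit sphere that is maximal in the sense that
it contains every unit vector at distance two from all opposites of its elements. -/
theorem exists_maximal_convex_subset_sphere {X : Type*} [NormedAddCommGroup X] [NormedSpace ℝ X]
    {u : X} (hu : ‖u‖ = 1) :
    ∃ D : Set X, u ∈ D ∧ Convex ℝ D ∧ (∀ d ∈ D, ‖d‖ = 1) ∧
      ∀ y : X, ‖y‖ = 1 → (∀ d ∈ D, ‖y + d‖ = 2) → y ∈ D := by
  obtain ⟨D, huD, hD⟩ := zorn_subset_nonempty {D : Set X | Convex ℝ D ∧ ∀ d ∈ D, ‖d‖ = 1}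
    (by
      intro c hc hchain hne
      refine ⟨⋃₀ c, ⟨hchain.directedOn.convex_sUnion fun s hs => (hc hs).1, ?_⟩,
        fun s hs => Set.subset_sUnion_of_mem hs⟩
      rintro d ⟨s, hs, hd⟩
      exact (hc hs).2 d hd) {u} ⟨convex_singleton u, by simpa using hu⟩
  refine ⟨D, huD rfl, hD.prop.1, hD.prop.2, fun y hy h => ?_⟩
  have hne : D.Nonempty := ⟨u, huD rfl⟩
  have hmem : convexHull ℝ (insert y D) ∈ {D : Set X | Convex ℝ D ∧ ∀ d ∈ D, ‖d‖ = 1} := by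
    refine ⟨convex_convexHull _ _, fun w hw => ?_⟩
    rw [convexHull_insert hne, hD.prop.1.convexHull_eq, mem_convexJoin] at hw
    obtain ⟨y', rfl, d, hd, a, b, ha, hb, hab, rfl⟩ := hw
    have hd1 := hD.prop.2 d hd
    apply le_antisymm
    · calc ‖a • y' + b • d‖ ≤ ‖a • y'‖ + ‖b • d‖ := norm_add_le _ _
        _ = 1 := by rw [norm_smul, norm_smul, hy, hd1, Real.norm_of_nonneg ha,
                      Real.norm_of_nonneg hb]; linarith
    -- The mirrored combination has norm at most one and the two sum to a vector of norm two, so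
    -- neither can be shorter than one.
    · have h2 : y' + d = (a • y' + b • d) + (b • y' + a • d) := by
        have : y' + d = (a + b) • y' + (a + b) • d := by simp [hab]
        rw [this]; module
      have h3 : ‖b • y' + a • d‖ ≤ 1 :=
        calc ‖b • y' + a • d‖ ≤ ‖b • y'‖ + ‖a • d‖ := norm_add_le _ _
          _ = 1 := by rw [norm_smul, norm_smul, hy, hd1, Real.norm_of_nonneg ha,
                        Real.norm_of_nonneg hb]; linarith
      have h4 := norm_add_le (a • y' + b • d) (b • y' + a • d)
      rw [← h2, h d hd] at h4
      linarith
  exact hD.le_of_ge hmem ((Set.subset_insert y D).trans (subset_convexHull ℝ _))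
    (subset_convexHull ℝ _ (Set.mem_insert y D))

theorem norm_add_eq_two_of_convex {X : Type*} [NormedAddCommGroup X] [NormedSpace ℝ X]
    {D : Set X} (hD : Convex ℝ D) (h1 : ∀ d ∈ D, ‖d‖ = 1) {x y : X} (hx : x ∈ D) (hy : y ∈ D) :
    ‖x + y‖ = 2 := by
  have h := h1 _ (hD hx hy (a := 1 / 2) (b := 1 / 2) (by norm_num) (by norm_num) (by norm_num))
  rw [← smul_add, norm_smul, Real.norm_of_nonneg (by norm_num)] at h
  linarith

/-- A convex subset of the unit sphere is supported by a functional of norm at most one. -/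
theorem exists_supporting_functional {X : Type*} [NormedAddCommGroup X] [NormedSpace ℝ X]
    {D : Set X} (hD : Convex ℝ D) (h1 : ∀ d ∈ D, ‖d‖ = 1) :
    ∃ φ : X →L[ℝ] ℝ, (∀ w, φ w ≤ ‖w‖) ∧ ∀ d ∈ D, φ d = 1 := by
  obtain ⟨φ, s, hball, hs⟩ := geometric_hahn_banach_open (convex_ball (0 : X) 1) isOpen_ball hD
    (Set.disjoint_left.2 fun w hw hwD => by
      rw [mem_ball_zero_iff, h1 w hwD] at hw
      exact lt_irrefl _ hw)
  have hs0 : 0 < s := by simpa using hball 0 (by simp)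
  have hle : ∀ w, (s⁻¹ • φ) w ≤ ‖w‖ := by
    intro w
    simp only [smul_apply, smul_eq_mul]
    rw [inv_mul_le_iff₀ hs0]
    refine le_of_forall_gt_imp_ge_of_dense fun c hc => ?_
    have hw : ‖w‖ < c / s := by rwa [lt_div_iff₀' hs0]
    have hcs : 0 < c / s := (norm_nonneg w).trans_lt hw
    have := hball ((c / s)⁻¹ • w) (by
      rw [mem_ball_zero_iff, norm_smul, norm_inv, Real.norm_of_nonneg hcs.le,
        inv_mul_lt_iff₀ hcs, mul_one]
      exact hw)
    rw [map_smul, smul_eq_mul, inv_mul_lt_iff₀ hcs, div_mul_cancel₀ _ hs0.ne'] at this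
    exact this.le
  refine ⟨s⁻¹ • φ, hle, fun d hd => le_antisymm ((hle d).trans (h1 d hd).le) ?_⟩
  have := hs d hd
  simp only [smul_apply, smul_eq_mul]
  rwa [le_inv_mul_iff₀ hs0, mul_one]

/-- If any two elements of the star of `e` add up to a vector of norm two, a surjective isometry of unit spheres
maps it onto a face of the unit ball, and the opposite star onto the opposite face. -/
theorem exists_functional_of_star {E X : Type*} [NormedAddCommGroup E]
    [NormedAddCommGroup X] [NormedSpace ℝ X]
    {Δ : sphere (0 : E) 1 → sphere (0 : X) 1} (hΔ : Isometry Δ) (hsurj : Function.Surjective Δ)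
    {e : sphere (0 : E) 1}
    (he : ∀ x y : sphere (0 : E) 1, ‖(x + e : E)‖ = 2 → ‖(y + e : E)‖ = 2 → ‖(x + y : E)‖ = 2) :
    ∃ φ : X →L[ℝ] ℝ, (∀ w, φ w ≤ ‖w‖) ∧
      (∀ x : sphere (0 : E) 1, φ (Δ x) = 1 ↔ ‖(x + e : E)‖ = 2) ∧
      ∀ x : sphere (0 : E) 1, φ (Δ x) = -1 ↔ ‖(-x + e : E)‖ = 2 := by
  have hnorm : ∀ w : sphere (0 : X) 1, ‖(w : X)‖ = 1 := fun w => norm_eq_of_mem_sphere w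
  have key : ∀ f g : sphere (0 : E) 1 → sphere (0 : X) 1, Function.Surjective f →
      (∀ x y, ‖(f x + g y : X)‖ = 2 ↔ ‖(x + y : E)‖ = 2) →
      ∃ D : Set X, Convex ℝ D ∧ (g e : X) ∈ D ∧ (∀ d ∈ D, ‖d‖ = 1) ∧
        (∀ y : X, ‖y‖ = 1 → (∀ d ∈ D, ‖y + d‖ = 2) → y ∈ D) ∧
        (∀ x, (f x : X) ∈ D → ‖(x + e : E)‖ = 2) ∧
        ∀ x : sphere (0 : E) 1, ‖(x + e : E)‖ = 2 → (g x : X) ∈ D := by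
    intro f g hf hfg
    obtain ⟨D, hgD, hconv, h1, hmax⟩ := exists_maximal_convex_subset_sphere (hnorm (g e))
    have hfD : ∀ x, (f x : X) ∈ D → ‖(x + e : E)‖ = 2 := fun x hx =>
      (hfg x e).1 (norm_add_eq_two_of_convex hconv h1 hx hgD)
    refine ⟨D, hconv, hgD, h1, hmax, hfD, fun x hx => hmax _ (hnorm _) fun d hd => ?_⟩
    obtain ⟨y, hy⟩ := hf ⟨d, by simpa using h1 d hd⟩
    have hyd : (f y : X) = d := by rw [hy]
    rw [← hyd, add_comm, hfg, add_comm]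
    exact he x y hx (hfD y (hyd ▸ hd))
  -- `Δ` is not known to commute with negation. Pairing it with `g` turns preserved distances into
  -- preserved norms of sums, and using `key` in both orders shows that `Δ` and `g` send the star to
  -- the same face.
  let g : sphere (0 : E) 1 → sphere (0 : X) 1 := fun x => -Δ (-x)
  have hg : Function.Surjective g := fun w => by
    obtain ⟨x, hx⟩ := hsurj (-w)
    exact ⟨-x, by simp [g, hx]⟩
  have hfg : ∀ x y, ‖(Δ x + g y : X)‖ = 2 ↔ ‖(x + y : E)‖ = 2 := by
    intro x y
    have h := hΔ.dist_eq x (-y)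
    rw [Subtype.dist_eq, Subtype.dist_eq, dist_eq_norm, dist_eq_norm] at h
    simp only [g, coe_neg_sphere, ← sub_eq_add_neg] at h ⊢
    rw [h, sub_neg_eq_add]
  obtain ⟨D, hconv, -, h1, hmax, hfD, hgD⟩ := key Δ g hsurj hfg
  obtain ⟨D', -, -, -, -, hgD', hfD'⟩ := key g Δ hg fun x y => by
    rw [add_comm, hfg, add_comm]
  have hfD2 : ∀ x : sphere (0 : E) 1, ‖(x + e : E)‖ = 2 → (Δ x : X) ∈ D := by
    intro x hx
    obtain ⟨y, hy⟩ := hg (Δ x)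
    rw [← hy]
    exact hgD y (hgD' y (hy ▸ hfD' x hx))
  have hgD2 : ∀ x, (g x : X) ∈ D → ‖(x + e : E)‖ = 2 := by
    intro x hx
    obtain ⟨y, hy⟩ := hsurj (g x)
    exact hgD' x (hy ▸ hfD' y (hfD y (hy ▸ hx)))
  obtain ⟨φ, hφ, hφD⟩ := exists_supporting_functional hconv h1
  have hiff : ∀ w : sphere (0 : X) 1, φ w = 1 ↔ (w : X) ∈ D := by
    refine fun w => ⟨fun hw => hmax _ (hnorm w) fun d hd => le_antisymm ?_ ?_, hφD _⟩
    · exact (norm_add_le _ _).trans (by rw [hnorm, h1 d hd]; norm_num)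
    · have := hφ (w + d)
      rw [map_add, hw, hφD d hd] at this
      linarith
  refine ⟨φ, hφ, fun x => (hiff _).trans ⟨hfD x, hfD2 x⟩, fun x => ?_⟩
  have h2 := (hiff (g (-x))).trans ⟨hgD2 (-x), hgD (-x)⟩
  simp only [g, neg_neg, coe_neg_sphere, map_neg] at h2
  rw [← h2, neg_eq_iff_eq_neg]

/-! ### Scalar lemmas. -/

theorem exists_norm_eq_one_and_eq_norm_mul (z : ℂ) : ∃ u : ℂ, ‖u‖ = 1 ∧ z = ‖z‖ * u := by
  by_cases hz : z = 0
  · exact ⟨1, by simp, by simp [hz]⟩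
  · have : (‖z‖ : ℂ) ≠ 0 := by simpa using hz
    exact ⟨z / ‖z‖, by simp [hz], by field_simp⟩

theorem eq_of_norm_add_eq_two {z w : ℂ} (hz : ‖z‖ ≤ 1) (hw : ‖w‖ ≤ 1) (h : ‖z + w‖ = 2) :
    z = w := by
  have hp := parallelogram_law_with_norm ℝ z w
  rw [h] at hp
  have h0 : ‖z - w‖ = 0 := by
    nlinarith [norm_nonneg z, norm_nonneg w, norm_nonneg (z - w)]
  exact sub_eq_zero.1 (norm_eq_zero.1 h0)

/-- Strict convexity of `ℂ`, in the form of the parallelogram law, makes metric midpoints unique. -/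
theorem eq_half_add_of_norm_sub_le {x y z : ℂ} {d : ℝ} (hxy : ‖x - y‖ = d)
    (hx : ‖z - x‖ ≤ d / 2) (hy : ‖z - y‖ ≤ d / 2) : z = (x + y) / 2 := by
  have hp := parallelogram_law_with_norm ℝ (z - x) (z - y)
  have h1 : (z - x) - (z - y) = -(x - y) := by ring
  rw [h1, norm_neg, hxy] at hp
  have h0 : ‖(z - x) + (z - y)‖ = 0 := by
    nlinarith [norm_nonneg (z - x), norm_nonneg (z - y), norm_nonneg ((z - x) + (z - y))]
  have := norm_eq_zero.1 h0
  linear_combination this / 2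

/-- A function that halves affinely from `0` and is tangent to a constant there is constant. -/
theorem eq_of_halving_of_tangent {h : ℝ → ℝ} {a b : ℝ} (hb : 0 ≤ b) (ha : |a| < 1)
    (hlow : ∀ s ∈ Set.Icc 0 b, 1 - h s ≤ √((1 - a) ^ 2 + s ^ 2))
    (hupp : ∀ s ∈ Set.Icc 0 b, 1 + h s ≤ √((1 + a) ^ 2 + s ^ 2))
    (hhalf : ∀ s ∈ Set.Icc 0 b, h (s / 2) = (h 0 + h s) / 2) : h b = a := by
  obtain ⟨ha1, ha2⟩ := abs_lt.1 ha
  have hsqrt : ∀ c s : ℝ, 0 < c → √(c ^ 2 + s ^ 2) ≤ c + s ^ 2 / (2 * c) := by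
    intro c s hc
    apply Real.sqrt_le_iff.2 ⟨by positivity, ?_⟩
    have : (c + s ^ 2 / (2 * c)) ^ 2 = c ^ 2 + s ^ 2 + (s ^ 2 / (2 * c)) ^ 2 := by
      field_simp
      ring
    rw [this]
    have := sq_nonneg (s ^ 2 / (2 * c))
    linarith
  obtain ⟨C, hC0, hC⟩ : ∃ C : ℝ, 0 ≤ C ∧ ∀ s ∈ Set.Icc 0 b, |h s - a| ≤ C * s ^ 2 := by
    have h1 : (0 : ℝ) < 1 - a := by linarith
    have h2 : (0 : ℝ) < 1 + a := by linarith
    refine ⟨1 / (2 * (1 - a)) + 1 / (2 * (1 + a)), by positivity, fun s hs => ?_⟩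
    have e1 := (hlow s hs).trans (hsqrt _ s h1)
    have e2 := (hupp s hs).trans (hsqrt _ s h2)
    have p1 : 0 ≤ s ^ 2 / (2 * (1 - a)) := by positivity
    have p2 : 0 ≤ s ^ 2 / (2 * (1 + a)) := by positivity
    have e3 : (1 / (2 * (1 - a)) + 1 / (2 * (1 + a))) * s ^ 2
        = s ^ 2 / (2 * (1 - a)) + s ^ 2 / (2 * (1 + a)) := by ring
    rw [e3, abs_le]
    constructor <;> linarith
  have h0 : h 0 = a := by
    have := hC 0 ⟨le_rfl, hb⟩
    have h3 : |h 0 - a| ≤ 0 := by simpa using this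
    linarith [abs_nonpos_iff.1 h3]
  -- Each halving of `s` halves `h s - a`, whereas the quadratic bound shrinks by four.
  have hn : ∀ n : ℕ, |h b - a| ≤ C * b ^ 2 * (1 / 2) ^ n := by
    intro n
    have hmem : ∀ n : ℕ, b * (1 / 2) ^ n ∈ Set.Icc 0 b := fun n =>
      ⟨by positivity, mul_le_of_le_one_right hb (pow_le_one₀ (by norm_num) (by norm_num))⟩
    have hiter : h b - a = 2 ^ n * (h (b * (1 / 2) ^ n) - a) := by
      induction n with
      | zero => simp
      | succ n ih =>
        have := hhalf _ (hmem n)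
        have e : b * (1 / 2) ^ (n + 1) = b * (1 / 2) ^ n / 2 := by ring
        rw [ih, e, this, h0]
        ring
    rw [hiter, abs_mul, abs_of_nonneg (by positivity)]
    calc (2 : ℝ) ^ n * |h (b * (1 / 2) ^ n) - a| ≤ 2 ^ n * (C * (b * (1 / 2) ^ n) ^ 2) := by
          gcongr
          exact hC _ (hmem n)
      _ = C * b ^ 2 * (1 / 2) ^ n * (2 ^ n * (1 / 2) ^ n) := by ring
      _ = C * b ^ 2 * (1 / 2) ^ n := by rw [← mul_pow]; norm_num
  have hlim : Filter.Tendsto (fun n : ℕ => C * b ^ 2 * (1 / 2 : ℝ) ^ n) Filter.atTop (nhds 0) := by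
    simpa using (tendsto_pow_atTop_nhds_zero_of_lt_one (r := (1 / 2 : ℝ)) (by norm_num)
      (by norm_num)).const_mul (C * b ^ 2)
  have := ge_of_tendsto' hlim hn
  linarith [abs_nonpos_iff.1 this]

theorem sqrt_le_one_iff {c : ℝ} : √c ≤ 1 ↔ c ≤ 1 := by
  rw [Real.sqrt_le_left zero_le_one, one_pow]

/-! ### The unit sphere of `ℓ∞(Γ)` and its coordinate stars. -/

section Sphere

variable {Γ : Type*}

theorem norm_apply_le_one (x : sphere (0 : lp (fun _ : Γ => ℂ) ∞) 1) (l : Γ) :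
    ‖(x : lp (fun _ : Γ => ℂ) ∞) l‖ ≤ 1 :=
  (lp.norm_apply_le_norm (by simp) _ l).trans (norm_eq_of_mem_sphere x).le

theorem exists_lt_norm_apply (x : sphere (0 : lp (fun _ : Γ => ℂ) ∞) 1) {c : ℝ} (hc0 : 0 ≤ c)
    (hc : c < 1) : ∃ l, c < ‖(x : lp (fun _ : Γ => ℂ) ∞) l‖ := by
  by_contra! h
  have := lp.norm_le_of_forall_le hc0 h
  rw [norm_eq_of_mem_sphere x] at this
  linarith

theorem exists_sphere_of_norm_apply_eq_one (y : Γ → ℂ) (hy : ∀ l, ‖y l‖ ≤ 1) {k : Γ}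
    (hk : ‖y k‖ = 1) :
    ∃ x : sphere (0 : lp (fun _ : Γ => ℂ) ∞) 1, ∀ l, (x : lp (fun _ : Γ => ℂ) ∞) l = y l := by
  let z : lp (fun _ : Γ => ℂ) ∞ := ⟨y, memℓp_infty ⟨1, by rintro _ ⟨l, rfl⟩; exact hy l⟩⟩
  refine ⟨⟨z, ?_⟩, fun l => rfl⟩
  rw [mem_sphere_zero_iff_norm]
  exact le_antisymm (lp.norm_le_of_forall_le zero_le_one hy)
    (hk ▸ lp.norm_apply_le_norm (by simp) z k)

theorem exists_sphere_update [DecidableEq Γ] (x : sphere (0 : lp (fun _ : Γ => ℂ) ∞) 1)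
    (k : Γ) {μ : ℂ} (hμ : ‖μ‖ = 1) :
    ∃ y : sphere (0 : lp (fun _ : Γ => ℂ) ∞) 1, (y : lp (fun _ : Γ => ℂ) ∞) k = μ ∧
      (∀ l ≠ k, (y : lp (fun _ : Γ => ℂ) ∞) l = (x : lp (fun _ : Γ => ℂ) ∞) l) ∧
      dist y x ≤ ‖μ - (x : lp (fun _ : Γ => ℂ) ∞) k‖ := by
  obtain ⟨y, hy⟩ := exists_sphere_of_norm_apply_eq_one
    (Function.update (x : lp (fun _ : Γ => ℂ) ∞) k μ) (k := k) (fun l => by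
      rcases eq_or_ne l k with rfl | h
      · simp [hμ]
      · simpa [h] using norm_apply_le_one x l) (by simpa using hμ)
  have hne : ∀ l ≠ k, (y : lp (fun _ : Γ => ℂ) ∞) l = (x : lp (fun _ : Γ => ℂ) ∞) l :=
    fun l hl => by rw [hy, Function.update_of_ne hl]
  refine ⟨y, by simp [hy], hne, ?_⟩
  rw [Subtype.dist_eq, dist_eq_norm]
  refine lp.norm_le_of_forall_le (norm_nonneg _) fun l => ?_
  rw [lp.coeFn_sub, Pi.sub_apply]
  rcases eq_or_ne l k with rfl | h
  · simp [hy]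
  · simp [hne l h]

/-- The witness is `μ` at `k` and zero elsewhere: away from `k` the sum has modulus at most one, so
norm two can only come from `k`. -/
theorem exists_sphere_star (k : Γ) {μ : ℂ} (hμ : ‖μ‖ = 1) :
    ∃ e : sphere (0 : lp (fun _ : Γ => ℂ) ∞) 1, ∀ x : sphere (0 : lp (fun _ : Γ => ℂ) ∞) 1,
      ‖(x + e : lp (fun _ : Γ => ℂ) ∞)‖ = 2 ↔ (x : lp (fun _ : Γ => ℂ) ∞) k = μ := by
  classical
  obtain ⟨e, he⟩ := exists_sphere_of_norm_apply_eq_one (Pi.single k μ : Γ → ℂ) (k := k)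
    (fun l => by
      rcases eq_or_ne l k with rfl | h
      · simp [hμ]
      · simp [h]) (by simpa using hμ)
  refine ⟨e, fun x => ⟨fun h => ?_, fun h => le_antisymm ?_ ?_⟩⟩
  · refine eq_of_norm_add_eq_two (norm_apply_le_one x k) hμ.le (le_antisymm ?_ ?_)
    · exact (norm_add_le _ _).trans (by linarith [norm_apply_le_one x k])
    · by_contra! hlt
      have hle : ‖(x + e : lp (fun _ : Γ => ℂ) ∞)‖
          ≤ max 1 ‖(x : lp (fun _ : Γ => ℂ) ∞) k + μ‖ := by
        refine lp.norm_le_of_forall_le (by positivity) fun l => ?_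
        rw [lp.coeFn_add, Pi.add_apply, he]
        rcases eq_or_ne l k with rfl | hl
        · simp
        · simpa [hl] using Or.inl (norm_apply_le_one x l)
      rw [h, le_max_iff] at hle
      rcases hle with hle | hle <;> linarith
  · exact (norm_add_le _ _).trans (by
      rw [norm_eq_of_mem_sphere x, norm_eq_of_mem_sphere e]; norm_num)
  · have := lp.norm_apply_le_norm (p := ∞) (by simp) (x + e : lp (fun _ : Γ => ℂ) ∞) k
    rw [lp.coeFn_add, Pi.add_apply, he, h, Pi.single_eq_same, ← two_mul, norm_mul, hμ] at this
    simpa using this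

/-! ### Coordinate functionals and preserved midpoints. -/

variable {X : Type*} [NormedAddCommGroup X] [NormedSpace ℝ X]
  {Δ : sphere (0 : lp (fun _ : Γ => ℂ) ∞) 1 → sphere (0 : X) 1}

theorem exists_functional_of_coordinate (hΔ : Isometry Δ) (hsurj : Function.Surjective Δ)
    (k : Γ) {μ : ℂ} (hμ : ‖μ‖ = 1) :
    ∃ φ : X →L[ℝ] ℝ, (∀ w, φ w ≤ ‖w‖) ∧
      (∀ x, φ (Δ x) = 1 ↔ (x : lp (fun _ : Γ => ℂ) ∞) k = μ) ∧
      ∀ x, φ (Δ x) = -1 ↔ (x : lp (fun _ : Γ => ℂ) ∞) k = -μ := by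
  obtain ⟨e, he⟩ := exists_sphere_star k hμ
  obtain ⟨φ, hφ, h1, h2⟩ := exists_functional_of_star hΔ hsurj (e := e) (fun x y hx hy => by
    rw [he] at hx hy
    refine le_antisymm ((norm_add_le _ _).trans ?_) ?_
    · rw [norm_eq_of_mem_sphere x, norm_eq_of_mem_sphere y]; norm_num
    · have := lp.norm_apply_le_norm (p := ∞) (by simp) (x + y : lp (fun _ : Γ => ℂ) ∞) k
      rw [lp.coeFn_add, Pi.add_apply, hx, hy, ← two_mul, norm_mul, hμ] at this
      simpa using this)
  refine ⟨φ, hφ, fun x => (h1 x).trans (he x), fun x => (h2 x).trans ?_⟩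
  have := he (-x)
  rw [coe_neg_sphere] at this
  rw [this, lp.coeFn_neg, Pi.neg_apply, neg_eq_iff_eq_neg]

/-- The functional for the common value at `k` keeps the midpoint of the images on the sphere, so it
is some `Δ z'`. Then `z'` lies within `d / 2` of `x` and `y`; the exact gap `d` forces `z' = z` off
`k`, and the functional forces it at `k`. -/
theorem map_midpoint_of_norm_sub_eq (hΔ : Isometry Δ) (hsurj : Function.Surjective Δ)
    {k : Γ} {x y z : sphere (0 : lp (fun _ : Γ => ℂ) ∞) 1} {d : ℝ} (hd : 0 ≤ d)
    (hk : ‖(x : lp (fun _ : Γ => ℂ) ∞) k‖ = 1)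
    (hxy : (y : lp (fun _ : Γ => ℂ) ∞) k = (x : lp (fun _ : Γ => ℂ) ∞) k)
    (hdist : ∀ l ≠ k, ‖(x : lp (fun _ : Γ => ℂ) ∞) l - (y : lp (fun _ : Γ => ℂ) ∞) l‖ = d)
    (hz : ∀ l, (z : lp (fun _ : Γ => ℂ) ∞) l
      = ((x : lp (fun _ : Γ => ℂ) ∞) l + (y : lp (fun _ : Γ => ℂ) ∞) l) / 2) :
    (Δ z : X) = (1 / 2 : ℝ) • ((Δ x : X) + Δ y) := by
  obtain ⟨φ, hφ, h1, -⟩ := exists_functional_of_coordinate hΔ hsurj k hk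
  have hx1 := (h1 x).2 rfl
  have hy1 := (h1 y).2 hxy
  set w : X := (1 / 2 : ℝ) • ((Δ x : X) + Δ y) with hw
  have hφw : φ w = 1 := by
    rw [hw, map_smul, map_add, hx1, hy1]; norm_num
  have hw1 : ‖w‖ = 1 := by
    refine le_antisymm ?_ (hφw ▸ hφ w)
    rw [hw, norm_smul, Real.norm_of_nonneg (by norm_num)]
    have := norm_add_le (Δ x : X) (Δ y)
    rw [norm_eq_of_mem_sphere, norm_eq_of_mem_sphere] at this
    linarith
  obtain ⟨z', hz'⟩ := hsurj ⟨w, by simpa using hw1⟩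
  have hzw : (Δ z' : X) = w := by rw [hz']
  have hxyd : dist x y ≤ d := by
    rw [Subtype.dist_eq, dist_eq_norm]
    refine lp.norm_le_of_forall_le hd fun l => ?_
    rw [lp.coeFn_sub, Pi.sub_apply]
    rcases eq_or_ne l k with rfl | h
    · simpa [hxy] using hd
    · exact (hdist l h).le
  have hXd : ‖(Δ x : X) - Δ y‖ ≤ d := by
    rw [← dist_eq_norm, ← Subtype.dist_eq, hΔ.dist_eq]; exact hxyd
  have hle : ∀ a : sphere (0 : lp (fun _ : Γ => ℂ) ∞) 1, ‖w - Δ a‖ ≤ d / 2 → ∀ l,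
      ‖(z' : lp (fun _ : Γ => ℂ) ∞) l - (a : lp (fun _ : Γ => ℂ) ∞) l‖ ≤ d / 2 := by
    intro a ha l
    have h := lp.norm_apply_le_norm (p := ∞) (by simp) (z' - a : lp (fun _ : Γ => ℂ) ∞) l
    rw [← dist_eq_norm (z' : lp (fun _ : Γ => ℂ) ∞), ← Subtype.dist_eq, ← hΔ.dist_eq,
      Subtype.dist_eq, dist_eq_norm, hzw] at h
    exact h.trans ha
  have hzx := hle x (by
    have : w - Δ x = (-(1 / 2) : ℝ) • ((Δ x : X) - Δ y) := by rw [hw]; module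
    rw [this, norm_smul]; norm_num; linarith)
  have hzy := hle y (by
    have : w - Δ y = (1 / 2 : ℝ) • ((Δ x : X) - Δ y) := by rw [hw]; module
    rw [this, norm_smul]; norm_num; linarith)
  have hzk : (z' : lp (fun _ : Γ => ℂ) ∞) k = (x : lp (fun _ : Γ => ℂ) ∞) k :=
    (h1 z').1 (by rw [hzw, hφw])
  have hzz : z = z' := by
    apply Subtype.ext
    apply lp.ext
    funext l
    rw [hz]
    rcases eq_or_ne l k with rfl | h
    · rw [hzk, hxy]; ring
    · exact (eq_half_add_of_norm_sub_le (hdist l h) (hzx l) (hzy l)).symm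
  rw [hzz, hzw]

/-- `φ ∘ Δ` is 1-Lipschitz; `x` is compared with its modifications to `μ` and `-μ` at `j`. -/
theorem dist_bounds_of_functional (hΔ : Isometry Δ) {j : Γ} {μ : ℂ} (hμ : ‖μ‖ = 1)
    {φ : X →L[ℝ] ℝ} (hφ : ∀ w, φ w ≤ ‖w‖)
    (h1 : ∀ x, φ (Δ x) = 1 ↔ (x : lp (fun _ : Γ => ℂ) ∞) j = μ)
    (h2 : ∀ x, φ (Δ x) = -1 ↔ (x : lp (fun _ : Γ => ℂ) ∞) j = -μ)
    (x : sphere (0 : lp (fun _ : Γ => ℂ) ∞) 1) {a b : ℝ}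
    (hx : (x : lp (fun _ : Γ => ℂ) ∞) j = μ * (a + b * Complex.I)) :
    1 - φ (Δ x) ≤ √((1 - a) ^ 2 + b ^ 2) ∧ 1 + φ (Δ x) ≤ √((1 + a) ^ 2 + b ^ 2) := by
  classical
  have hLip : ∀ y z, φ (Δ y) - φ (Δ z) ≤ dist y z := fun y z => by
    rw [← hΔ.dist_eq, Subtype.dist_eq, dist_eq_norm, ← map_sub]
    exact hφ _
  constructor
  · obtain ⟨y, hy, -, hyx⟩ := exists_sphere_update x j hμ
    have := (hLip y x).trans hyx
    rw [(h1 y).2 hy, hx] at this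
    refine this.trans_eq ?_
    have e : μ - μ * (a + b * Complex.I) = μ * ((1 - a : ℝ) + (-b : ℝ) * Complex.I) := by
      push_cast; ring
    rw [e, norm_mul, hμ, one_mul, Complex.norm_add_mul_I, neg_sq]
  · obtain ⟨y, hy, -, hyx⟩ := exists_sphere_update x j (μ := -μ) (by simpa using hμ)
    rw [dist_comm] at hyx
    have := (hLip x y).trans hyx
    rw [(h2 y).2 hy, hx, sub_neg_eq_add, add_comm] at this
    refine this.trans_eq ?_
    have e : -μ - μ * (a + b * Complex.I) = -μ * ((1 + a : ℝ) + (b : ℝ) * Complex.I) := by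
      push_cast; ring
    rw [e, norm_mul, norm_neg, hμ, one_mul, Complex.norm_add_mul_I]

/-! ### The value of the functional at an arbitrary point. -/

/-- The unimodular coordinate `k` stays fixed, which keeps a segment through `x` on the sphere while
all other coordinates move at unit speed. -/
theorem functional_eq_of_norm_apply_eq_one (hΔ : Isometry Δ) (hsurj : Function.Surjective Δ)
    {j : Γ} {μ : ℂ} (hμ : ‖μ‖ = 1) {φ : X →L[ℝ] ℝ} (hφ : ∀ w, φ w ≤ ‖w‖)
    (h1 : ∀ x, φ (Δ x) = 1 ↔ (x : lp (fun _ : Γ => ℂ) ∞) j = μ)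
    (h2 : ∀ x, φ (Δ x) = -1 ↔ (x : lp (fun _ : Γ => ℂ) ∞) j = -μ)
    (x : sphere (0 : lp (fun _ : Γ => ℂ) ∞) 1) {k : Γ} (hkj : k ≠ j)
    (hk : ‖(x : lp (fun _ : Γ => ℂ) ∞) k‖ = 1) {a b : ℝ}
    (hx : (x : lp (fun _ : Γ => ℂ) ∞) j = μ * (a + b * Complex.I)) : φ (Δ x) = a := by
  classical
  have hab : a ^ 2 + b ^ 2 ≤ 1 := by
    have h := norm_apply_le_one x j
    rw [hx, norm_mul, hμ, one_mul, Complex.norm_add_mul_I] at h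
    exact sqrt_le_one_iff.1 h
  rcases eq_or_ne b 0 with rfl | hb
  · obtain ⟨e1, e2⟩ := dist_bounds_of_functional hΔ hμ hφ h1 h2 x hx
    have ha := abs_le_one_iff_mul_self_le_one.2 (show a * a ≤ 1 by nlinarith)
    obtain ⟨ha1, ha2⟩ := abs_le.1 ha
    rw [zero_pow two_ne_zero, add_zero, Real.sqrt_sq (by linarith)] at e1 e2
    linarith
  have hb2 : 0 < b ^ 2 := by positivity
  have ha : |a| < 1 := (sq_lt_one_iff_abs_lt_one a).1 (by linarith)
  have hb1 : |b| ≤ 1 := (sq_le_one_iff_abs_le_one b).1 (by nlinarith [sq_nonneg a])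
  obtain ⟨σ, hσ1, hσ⟩ : ∃ σ : ℝ, |σ| = 1 ∧ σ * |b| = b := by
    rcases le_total 0 b with h | h
    · exact ⟨1, by simp, by simp [abs_of_nonneg h]⟩
    · exact ⟨-1, by simp, by simp [abs_of_nonpos h]⟩
  choose u hu1 hu using fun l => exists_norm_eq_one_and_eq_norm_mul
    ((x : lp (fun _ : Γ => ℂ) ∞) l)
  -- Coordinate `j` moves perpendicularly to `μ`, keeping `a` fixed; the others move radially and
  -- stay in the disc because `|b| ≤ 1`. The point `x` is reached at parameter `|b|`, and the
  -- imaginary part at `j`, relative to `μ`, vanishes at parameter `0`.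
  let q : Γ → ℂ := fun l => if l = k then 0 else if l = j then μ * (σ * Complex.I) else u l
  have hqk : q k = 0 := by simp [q]
  have hqj : q j = μ * (σ * Complex.I) := by simp [q, hkj.symm]
  have hq1 : ∀ l ≠ k, ‖q l‖ = 1 := by
    intro l hl
    rcases eq_or_ne l j with rfl | hlj
    · rw [hqj]; simp [hμ, hσ1]
    · simp [q, hl, hlj, hu1]
  have hσ' : (σ : ℂ) * (|b| : ℝ) = b := by exact_mod_cast hσ
  have hj : ∀ s : ℝ, (x : lp (fun _ : Γ => ℂ) ∞) j + ((s - |b| : ℝ) : ℂ) * q j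
      = μ * (a + (s * σ : ℝ) * Complex.I) := by
    intro s
    rw [hx, hqj]
    push_cast
    linear_combination -μ * Complex.I * hσ'
  have hex : ∀ s : ℝ, ∃ y : sphere (0 : lp (fun _ : Γ => ℂ) ∞) 1, s ∈ Set.Icc 0 |b| →
      ∀ l, (y : lp (fun _ : Γ => ℂ) ∞) l
        = (x : lp (fun _ : Γ => ℂ) ∞) l + ((s - |b| : ℝ) : ℂ) * q l := by
    intro s
    by_cases hs : s ∈ Set.Icc 0 |b|
    · obtain ⟨y, hy⟩ := exists_sphere_of_norm_apply_eq_one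
        (fun l => (x : lp (fun _ : Γ => ℂ) ∞) l + ((s - |b| : ℝ) : ℂ) * q l) (k := k) (fun l => by
          rcases eq_or_ne l k with rfl | hlk
          · simp [hqk, hk]
          rcases eq_or_ne l j with rfl | hlj
          · simp only [hj]
            rw [norm_mul, hμ, one_mul, Complex.norm_add_mul_I, sqrt_le_one_iff, mul_pow,
              ← sq_abs σ, hσ1]
            have : s ^ 2 ≤ b ^ 2 := by
              rw [← sq_abs b]
              exact pow_le_pow_left₀ hs.1 hs.2 2
            linarith
          · have hql : q l = u l := by simp [q, hlk, hlj]
            have e : (x : lp (fun _ : Γ => ℂ) ∞) l + ((s - |b| : ℝ) : ℂ) * u l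
                = ((‖(x : lp (fun _ : Γ => ℂ) ∞) l‖ + (s - |b|) : ℝ) : ℂ) * u l := by
              conv_lhs => rw [hu l]
              push_cast
              ring
            simp only [hql]
            rw [e, norm_mul, hu1, mul_one, Complex.norm_real, Real.norm_eq_abs, abs_le]
            have := norm_apply_le_one x l
            have := norm_nonneg ((x : lp (fun _ : Γ => ℂ) ∞) l)
            constructor <;> linarith [hs.1, hs.2]) (by simp [hqk, hk])
      exact ⟨y, fun _ => hy⟩
    · exact ⟨x, fun h => absurd h hs⟩
  choose y hy using hex
  have hyb : y |b| = x := by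
    apply Subtype.ext
    apply lp.ext
    funext l
    rw [hy _ ⟨abs_nonneg b, le_rfl⟩]
    simp
  have hbound : ∀ s ∈ Set.Icc 0 |b|, 1 - φ (Δ (y s)) ≤ √((1 - a) ^ 2 + s ^ 2) ∧
      1 + φ (Δ (y s)) ≤ √((1 + a) ^ 2 + s ^ 2) := by
    intro s hs
    have h := dist_bounds_of_functional hΔ hμ hφ h1 h2 (y s) (a := a) (b := s * σ)
      (by rw [hy s hs, hj])
    have e : (s * σ) ^ 2 = s ^ 2 := by rw [mul_pow, ← sq_abs σ, hσ1]; ring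
    rwa [e] at h
  rw [← hyb]
  refine eq_of_halving_of_tangent (h := fun s => φ (Δ (y s))) (abs_nonneg b) ha
    (fun s hs => (hbound s hs).1) (fun s hs => (hbound s hs).2) fun s hs => ?_
  have h0 : (0 : ℝ) ∈ Set.Icc 0 |b| := ⟨le_rfl, abs_nonneg b⟩
  have hs2 : s / 2 ∈ Set.Icc 0 |b| := ⟨by linarith [hs.1], by linarith [hs.1, hs.2]⟩
  have hmid := map_midpoint_of_norm_sub_eq hΔ hsurj (k := k) (x := y 0) (y := y s) (z := y (s / 2))
    (d := s) hs.1 (by rw [hy 0 h0, hqk]; simpa using hk) (by rw [hy 0 h0, hy s hs, hqk]; simp)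
    (fun l hl => by
      rw [hy 0 h0, hy s hs]
      have e : (x : lp (fun _ : Γ => ℂ) ∞) l + ((0 - |b| : ℝ) : ℂ) * q l
          - ((x : lp (fun _ : Γ => ℂ) ∞) l + ((s - |b| : ℝ) : ℂ) * q l)
          = -((s : ℝ) : ℂ) * q l := by push_cast; ring
      rw [e, norm_mul, hq1 l hl, norm_neg, Complex.norm_real, Real.norm_of_nonneg hs.1, mul_one])
    (fun l => by
      rw [hy 0 h0, hy s hs, hy _ hs2]
      push_cast
      ring)
  simp only [hmid, map_smul, map_add, smul_eq_mul]
  ring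

/-- Pushing a nearly unimodular coordinate radially to the circle moves `x` by less than `ε`, so the
Lipschitz bound reduces to the unimodular case. -/
theorem functional_eq_of_frequently_norm_apply (hΔ : Isometry Δ) (hsurj : Function.Surjective Δ)
    {j : Γ} {μ : ℂ} (hμ : ‖μ‖ = 1) {φ : X →L[ℝ] ℝ} (hφ : ∀ w, φ w ≤ ‖w‖)
    (h1 : ∀ x, φ (Δ x) = 1 ↔ (x : lp (fun _ : Γ => ℂ) ∞) j = μ)
    (h2 : ∀ x, φ (Δ x) = -1 ↔ (x : lp (fun _ : Γ => ℂ) ∞) j = -μ)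
    (x : sphere (0 : lp (fun _ : Γ => ℂ) ∞) 1)
    (hk : ∀ ε > 0, ∃ k ≠ j, 1 - ε < ‖(x : lp (fun _ : Γ => ℂ) ∞) k‖) {a b : ℝ}
    (hx : (x : lp (fun _ : Γ => ℂ) ∞) j = μ * (a + b * Complex.I)) : φ (Δ x) = a := by
  classical
  have hLip : ∀ y z, φ (Δ y) - φ (Δ z) ≤ dist y z := fun y z => by
    rw [← hΔ.dist_eq, Subtype.dist_eq, dist_eq_norm, ← map_sub]
    exact hφ _
  refine eq_of_forall_dist_le fun ε hε => ?_
  obtain ⟨k, hkj, hkε⟩ := hk ε hε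
  obtain ⟨u, hu1, hu⟩ := exists_norm_eq_one_and_eq_norm_mul ((x : lp (fun _ : Γ => ℂ) ∞) k)
  obtain ⟨y, hyk, hyne, hyx⟩ := exists_sphere_update x k hu1
  have hφy : φ (Δ y) = a := functional_eq_of_norm_apply_eq_one hΔ hsurj hμ hφ h1 h2 y hkj
    (by rw [hyk, hu1]) (by rw [hyne j hkj.symm, hx])
  have hd : dist y x ≤ ε := by
    refine hyx.trans ?_
    have e : u - (x : lp (fun _ : Γ => ℂ) ∞) k
        = ((1 - ‖(x : lp (fun _ : Γ => ℂ) ∞) k‖ : ℝ) : ℂ) * u := by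
      conv_lhs => rw [hu]
      push_cast
      ring
    rw [e, norm_mul, hu1, mul_one, Complex.norm_real,
      Real.norm_of_nonneg (by linarith [norm_apply_le_one x k])]
    linarith
  have e1 := hLip y x
  have e2 := hLip x y
  rw [dist_comm] at e2
  rw [Real.dist_eq, abs_le, ← hφy]
  constructor <;> linarith

theorem functional_eq [Nontrivial Γ] (hΔ : Isometry Δ) (hsurj : Function.Surjective Δ)
    {j : Γ} {μ : ℂ} (hμ : ‖μ‖ = 1) {φ : X →L[ℝ] ℝ} (hφ : ∀ w, φ w ≤ ‖w‖)
    (h1 : ∀ x, φ (Δ x) = 1 ↔ (x : lp (fun _ : Γ => ℂ) ∞) j = μ)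
    (h2 : ∀ x, φ (Δ x) = -1 ↔ (x : lp (fun _ : Γ => ℂ) ∞) j = -μ)
    (x : sphere (0 : lp (fun _ : Γ => ℂ) ∞) 1) {a b : ℝ}
    (hx : (x : lp (fun _ : Γ => ℂ) ∞) j = μ * (a + b * Complex.I)) : φ (Δ x) = a := by
  classical
  rcases (norm_apply_le_one x j).lt_or_eq with hlt | hxj
  · refine functional_eq_of_frequently_norm_apply hΔ hsurj hμ hφ h1 h2 x (fun ε hε => ?_) hx
    -- Including the modulus at `j` in the threshold rules out `k = j`.
    obtain ⟨k, hk⟩ := exists_lt_norm_apply x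
      (c := max (1 - ε) ‖(x : lp (fun _ : Γ => ℂ) ∞) j‖) (by positivity)
      (max_lt (by linarith) hlt)
    obtain ⟨hk1, hk2⟩ := max_lt_iff.1 hk
    exact ⟨k, fun h => absurd hk2 (by rw [h]; exact lt_irrefl _), hk1⟩
  obtain ⟨k₀, hk₀⟩ := exists_ne j
  have : Nonempty {l : Γ // l ≠ j} := ⟨⟨k₀, hk₀⟩⟩
  -- When `x j` is unimodular, the other coordinates may stay away from the circle. Moving each
  -- perpendicularly to itself by `±√(1 - r)` brings their supremum to one, and `x` is the midpoint
  -- of the two results.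
  let r : ℝ := ⨆ l : {l : Γ // l ≠ j}, ‖(x : lp (fun _ : Γ => ℂ) ∞) l‖ ^ 2
  have hsq : ∀ l, ‖(x : lp (fun _ : Γ => ℂ) ∞) l‖ ^ 2 ≤ 1 := fun l =>
    pow_le_one₀ (norm_nonneg _) (norm_apply_le_one x l)
  have hr1 : r ≤ 1 := ciSup_le fun l => hsq l
  have hbdd : BddAbove (Set.range fun l : {l : Γ // l ≠ j} =>
      ‖(x : lp (fun _ : Γ => ℂ) ∞) l‖ ^ 2) := ⟨1, by rintro _ ⟨l, rfl⟩; exact hsq l⟩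
  have hle : ∀ l ≠ j, ‖(x : lp (fun _ : Γ => ℂ) ∞) l‖ ^ 2 ≤ r := fun l hl =>
    le_ciSup hbdd (⟨l, hl⟩ : {l : Γ // l ≠ j})
  choose u hu1 hu using fun l => exists_norm_eq_one_and_eq_norm_mul
    ((x : lp (fun _ : Γ => ℂ) ∞) l)
  have hnorm : ∀ t : ℝ, ∀ l, ‖(x : lp (fun _ : Γ => ℂ) ∞) l + t * (u l * Complex.I)‖
      = √(‖(x : lp (fun _ : Γ => ℂ) ∞) l‖ ^ 2 + t ^ 2) := by
    intro t l
    have e : (x : lp (fun _ : Γ => ℂ) ∞) l + t * (u l * Complex.I)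
        = u l * ((‖(x : lp (fun _ : Γ => ℂ) ∞) l‖ : ℝ) + t * Complex.I) := by
      conv_lhs => rw [hu l]
      ring
    rw [e, norm_mul, hu1, one_mul, Complex.norm_add_mul_I]
  let q : Γ → ℂ := fun l => if l = j then 0 else u l * Complex.I
  have hqj : q j = 0 := by simp [q]
  have hqne : ∀ l ≠ j, q l = u l * Complex.I := fun l hl => by simp [q, hl]
  have hex : ∀ t : ℝ, t ^ 2 = 1 - r → ∃ y : sphere (0 : lp (fun _ : Γ => ℂ) ∞) 1,
      (∀ l, (y : lp (fun _ : Γ => ℂ) ∞) l = (x : lp (fun _ : Γ => ℂ) ∞) l + t * q l) ∧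
      φ (Δ y) = a := by
    intro t ht
    obtain ⟨y, hy⟩ := exists_sphere_of_norm_apply_eq_one
      (fun l => (x : lp (fun _ : Γ => ℂ) ∞) l + t * q l) (k := j) (fun l => by
        rcases eq_or_ne l j with rfl | hl
        · simp [hqj, hxj]
        · simp only [hqne l hl]
          rw [hnorm, sqrt_le_one_iff, ht]
          linarith [hle l hl]) (by simp [hqj, hxj])
    refine ⟨y, hy, functional_eq_of_frequently_norm_apply hΔ hsurj hμ hφ h1 h2 y
      (fun ε hε => ?_) (by rw [hy, hqj, mul_zero, add_zero, hx])⟩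
    obtain ⟨⟨l, hl⟩, hlr⟩ := exists_lt_of_lt_ciSup (show r - ε < r by linarith)
    refine ⟨l, hl, ?_⟩
    rw [hy, hqne l hl, hnorm, ht]
    have h3 : 1 - ε < ‖(x : lp (fun _ : Γ => ℂ) ∞) l‖ ^ 2 + (1 - r) := by
      simp only at hlr; linarith
    -- On `[0, 1]` the square root dominates the identity.
    refine h3.trans_le (Real.le_sqrt_of_sq_le ?_)
    have h4 := hle l hl
    have h5 := sq_nonneg ‖(x : lp (fun _ : Γ => ℂ) ∞) l‖
    nlinarith
  have ht : √(1 - r) ^ 2 = 1 - r := Real.sq_sqrt (by linarith)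
  obtain ⟨y, hy, hφy⟩ := hex (√(1 - r)) ht
  obtain ⟨z, hz, hφz⟩ := hex (-√(1 - r)) (by rw [neg_sq, ht])
  have hmid := map_midpoint_of_norm_sub_eq hΔ hsurj (k := j) (x := y) (y := z) (z := x)
    (d := 2 * √(1 - r)) (by positivity) (by rw [hy, hqj]; simpa using hxj)
    (by rw [hy, hz, hqj]; simp)
    (fun l hl => by
      rw [hy, hz]
      have e : (x : lp (fun _ : Γ => ℂ) ∞) l + (√(1 - r) : ℝ) * q l
          - ((x : lp (fun _ : Γ => ℂ) ∞) l + ((-√(1 - r) : ℝ) : ℂ) * q l)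
          = ((2 * √(1 - r) : ℝ) : ℂ) * q l := by push_cast; ring
      rw [e, norm_mul, hqne l hl, Complex.norm_real, Real.norm_of_nonneg (by positivity)]
      simp [hu1])
    (fun l => by
      rw [hy, hz]
      push_cast
      ring)
  rw [hmid, map_smul, map_add, hφy, hφz, smul_eq_mul]
  ring

theorem exists_coordinate_functional [Nontrivial Γ] (hΔ : Isometry Δ)
    (hsurj : Function.Surjective Δ) (j : Γ) {μ : ℂ} (hμ : ‖μ‖ = 1) :
    ∃ φ : X →L[ℝ] ℝ, (∀ w, |φ w| ≤ ‖w‖) ∧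
      ∀ x : sphere (0 : lp (fun _ : Γ => ℂ) ∞) 1, ∀ a b : ℝ,
      (x : lp (fun _ : Γ => ℂ) ∞) j = μ * (a + b * Complex.I) → φ (Δ x) = a := by
  obtain ⟨φ, hφ, h1, h2⟩ := exists_functional_of_coordinate hΔ hsurj j hμ
  refine ⟨φ, fun w => abs_le'.2 ⟨hφ w, ?_⟩, fun x a b hx =>
    functional_eq hΔ hsurj hμ hφ h1 h2 x hx⟩
  simpa using hφ (-w)

/-! ### The real-linear left inverse and the extension. -/

/-- A surjective isometry from the unit sphere of `ℓ∞(Γ)` has a real-linear left inverse. -/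
theorem exists_linearMap_apply_eq [Nontrivial Γ] (hΔ : Isometry Δ)
    (hsurj : Function.Surjective Δ) :
    ∃ R : X →ₗ[ℝ] lp (fun _ : Γ => ℂ) ∞, ∀ x, R (Δ x) = x := by
  choose φ hφ hφΔ using fun j =>
    exists_coordinate_functional hΔ hsurj j (μ := 1) (by simp)
  choose ψ hψ hψΔ using fun j =>
    exists_coordinate_functional hΔ hsurj j (μ := Complex.I) (by simp)
  have hmem : ∀ w : X, Memℓp (fun j => (φ j w : ℂ) + ψ j w * Complex.I) ∞ := by
    refine fun w => memℓp_infty ⟨‖w‖ + ‖w‖, ?_⟩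
    rintro _ ⟨j, rfl⟩
    refine (norm_add_le _ _).trans ?_
    rw [norm_mul, Complex.norm_I, mul_one, Complex.norm_real, Complex.norm_real]
    exact add_le_add (hφ j w) (hψ j w)
  refine ⟨{ toFun := fun w => ⟨_, hmem w⟩, map_add' := ?_, map_smul' := ?_ }, fun x => ?_⟩
  · intro v w
    apply lp.ext
    funext j
    simp only [lp.coeFn_add, Pi.add_apply, map_add]
    push_cast
    ring
  · intro c w
    apply lp.ext
    funext j
    simp only [lp.coeFn_smul, Pi.smul_apply, map_smul, RingHom.id_apply, smul_eq_mul,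
      Complex.real_smul]
    push_cast
    ring
  · apply lp.ext
    funext j
    have hx := Complex.re_add_im ((x : lp (fun _ : Γ => ℂ) ∞) j)
    have e1 := hφΔ j x _ _ (by rw [one_mul]; exact hx.symm)
    have e2 := hψΔ j x ((x : lp (fun _ : Γ => ℂ) ∞) j).im (-((x : lp (fun _ : Γ => ℂ) ∞) j).re)
      (by
        conv_lhs => rw [← hx]
        push_cast
        linear_combination (((x : lp (fun _ : Γ => ℂ) ∞) j).re : ℂ) * Complex.I_sq)
    simp only [LinearMap.coe_mk, AddHom.coe_mk, e1, e2]
    exact hx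

end Sphere

theorem exists_smul_sphere_eq {E : Type*} [NormedAddCommGroup E] [NormedSpace ℝ E] {z : E}
    (hz : z ≠ 0) : ∃ x : sphere (0 : E) 1, z = ‖z‖ • (x : E) := by
  have h : ‖z‖ ≠ 0 := norm_ne_zero_iff.2 hz
  exact ⟨⟨‖z‖⁻¹ • z, by simp [norm_smul, h]⟩, by simp [h]⟩

theorem theorem1p1 {Γ : Type*} [Infinite Γ]
    {X : Type*} [NormedAddCommGroup X] [NormedSpace ℂ X] [CompleteSpace X]
    (Δ : sphere (0 : lp (fun _ : Γ => ℂ) ∞) 1 → sphere (0 : X) 1)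
    (hΔ : Isometry Δ) (hsurj : Function.Surjective Δ) :
    ∃! T : lp (fun _ : Γ => ℂ) ∞ ≃ₗᵢ[ℝ] X,
      ∀ x : sphere (0 : lp (fun _ : Γ => ℂ) ∞) 1,
        T (x : lp (fun _ : Γ => ℂ) ∞) = (Δ x : X) := by
  obtain ⟨R, hR⟩ := exists_linearMap_apply_eq hΔ hsurj
  -- Every nonzero vector of `X` is a positive multiple of some `Δ x`, and `R` sends `Δ x` to the
  -- unit vector `x`.
  have hnorm : ∀ w, ‖R w‖ = ‖w‖ := by
    intro w
    rcases eq_or_ne w 0 with rfl | hw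
    · simp
    obtain ⟨v, hv⟩ := exists_smul_sphere_eq hw
    obtain ⟨x, rfl⟩ := hsurj v
    conv_lhs => rw [hv]
    rw [map_smul, hR, norm_smul, norm_norm, norm_eq_of_mem_sphere, mul_one]
  have hRsurj : Function.Surjective R := by
    intro z
    rcases eq_or_ne z 0 with rfl | hz
    · exact ⟨0, map_zero R⟩
    obtain ⟨x, hx⟩ := exists_smul_sphere_eq hz
    exact ⟨‖z‖ • (Δ x : X), by rw [map_smul, hR, ← hx]⟩
  let S : X ≃ₗᵢ[ℝ] lp (fun _ : Γ => ℂ) ∞ := LinearIsometryEquiv.ofSurjective ⟨R, hnorm⟩ hRsurj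
  have hS : ∀ x, S (Δ x) = x := hR
  refine ⟨S.symm, fun x => (S.symm_apply_eq).2 (hS x).symm, fun T hT => ?_⟩
  ext z
  rcases eq_or_ne z 0 with rfl | hz
  · simp
  obtain ⟨x, hx⟩ := exists_smul_sphere_eq hz
  rw [hx, map_smul, map_smul, hT, (S.symm_apply_eq).2 (hS x).symm]
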